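/- Let $X=(V,E)$ be a finite digraph ($E\subseteq V\times V$, loops allowed) with vertices labeled $v_1,\dots,v_n$. A listing $\sigma=(\sigma_1,\dots,\sigma_n)$ of $V$ (each vertex exactly once) is called $(f,X)$-friendly for a coloring $f:V\to\mathbb{P}=\{1,2,3,\dots\}$ if $f(\sigma_1)\le\cdots\le f(\sigma_n)$ and $f(\sigma_j)<f(\sigma_{j+1})$ whenever $(\sigma_j,\sigma_{j+1})\in E$. The Redei-Berge function of $X$ in noncommuting variables $x_1,x_2,\dots$ is the formal power series \[W_X=\sum_{f:V\to\mathbb{P}}\ \sum_{\sigma\ (f,X)\text{-friendly}} x_{f(v_1)}x_{f(v_2)}\cdots x_{f(v_n)}.\] For a set partition $\pi$ of $[n]$ let $m_\pi=\sum x_{i_1}\cdots x_{i_n}$, summed over all sequences of positive integers such that $i_j=i_k$ if and only if $j,k$ are in the same block of $\pi$, and let $p_\pi=\sum x_{i_1}\cdots x_{i_n}$, summed over all sequences of positive integers such that $i_j=i_k$ whenever $j,k$ are in the same block of $\pi$. Then $W_X$ has a unique expansion $W_X=\sum_{\pi}c_\pi p_\pi$ with $c_\pi\in\mathbb{C}$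 and a unique expansion $W_X=\sum_{\pi}d_\pi m_\pi$ with $d_\pi\in\mathbb{C}$, where $\pi$ ranges over all set partitions of $[n]$, and all the coefficients $c_\pi$ and $d_\pi$ are integers. If moreover $X$ has no directed cycle (with distinct vertices) of even length, where a pair of opposite edges between two distinct vertices counts as a cycle of length $2$, then every nonzero coefficient $c_\pi$ is a positive integer. -/

import Mathlib

/-- Formal power series over `ℂ` in noncommuting variables `x₁, x₂, …` indexed by the positive
integers: a series is the function that gives the coefficient of each word. -/
abbrev NCSeries : Type := FreeMonoid ℕ+ → ℂ

namespace NCSeries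

/-- The monomial `x_{i₁} x_{i₂} ⋯ x_{iₙ}` as a word. -/
def word {n : ℕ} (i : Fin n → ℕ+) : FreeMonoid ℕ+ :=
  FreeMonoid.ofList (List.ofFn i)

/-- The formal sum `∑ t a`, over all indices `a`, of a family of monomials in which every monomial
occurs finitely often: the coefficient of a word is the number of its occurrences. -/
noncomputable def formalSum {ι : Type*} (t : ι → FreeMonoid ℕ+) : NCSeries :=
  fun w => (Nat.card {a : ι // t a = w} : ℂ)

end NCSeries

/-- The set partitions of an `n`-element set of positions (numbered from `0`). -/
abbrev SetPartition (n : ℕ) : Type := Finpartition (Finset.univ : Finset (Fin n))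

namespace SetPartition

/-- `j` and `k` lie in the same block of `π`. -/
def SameBlock {n : ℕ} (π : SetPartition n) (j k : Fin n) : Prop :=
  ∃ B ∈ π.parts, j ∈ B ∧ k ∈ B

/-- The monomial symmetric function `m_π` in noncommuting variables: the sum of all
`x_{i₁} ⋯ x_{iₙ}` with `i_j = i_k` if and only if `j` and `k` are in the same block of `π`. -/
noncomputable def monomialSymm {n : ℕ} (π : SetPartition n) : NCSeries :=
  NCSeries.formalSum
    (fun i : {i : Fin n → ℕ+ // ∀ j k, i j = i k ↔ π.SameBlock j k} => NCSeries.word i.1)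

/-- The power sum symmetric function `p_π` in noncommuting variables: the sum of all
`x_{i₁} ⋯ x_{iₙ}` with `i_j = i_k` whenever `j` and `k` are in the same block of `π`. -/
noncomputable def powerSum {n : ℕ} (π : SetPartition n) : NCSeries :=
  NCSeries.formalSum
    (fun i : {i : Fin n → ℕ+ // ∀ j k, π.SameBlock j k → i j = i k} => NCSeries.word i.1)

end SetPartition

namespace Digraph

/-- The listing `σ` of the vertices is `(f, X)`-friendly: `f` is weakly increasing along `σ`, and
strictly increasing at each step of `σ` that is an edge of `X`. -/
def Friendly {V : Type*} {n : ℕ} (X : Digraph V) (f : V → ℕ+) (σ : Fin n ≃ V) : Prop :=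
  (∀ (j : ℕ) (h : j + 1 < n), f (σ ⟨j, by omega⟩) ≤ f (σ ⟨j + 1, h⟩)) ∧
  (∀ (j : ℕ) (h : j + 1 < n), X.Adj (σ ⟨j, by omega⟩) (σ ⟨j + 1, h⟩) →
    f (σ ⟨j, by omega⟩) < f (σ ⟨j + 1, h⟩))

/-- The Redei-Berge function `W_X` in noncommuting variables of a digraph `X` whose vertices are
labeled `v₁, …, vₙ`: the sum of `x_{f(v₁)} ⋯ x_{f(vₙ)}` over all colorings `f` of the vertices by
positive integers and all `(f, X)`-friendly listings `σ`. -/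
noncomputable def redeiBerge {V : Type*} {n : ℕ} (X : Digraph V) (v : Fin n ≃ V) : NCSeries :=
  NCSeries.formalSum
    (fun a : {a : (V → ℕ+) × (Fin n ≃ V) // X.Friendly a.1 a.2} =>
      NCSeries.word (fun k => a.1.1 (v k)))

/-- `X` has a directed cycle of length `k ≥ 1`: distinct vertices `c₁, …, c_k` such that
`(c₁, c₂), …, (c_{k-1}, c_k), (c_k, c₁)` are edges. Loops are the cycles of length `1`. -/
def HasCycleOfLength {V : Type*} (X : Digraph V) (k : ℕ) : Prop :=
  1 ≤ k ∧ ∃ c : Fin k → V, Function.Injective c ∧ ∀ i, X.Adj (c i) (c (finRotate k i))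

end Digraph

/-! The core is an identity valid for arbitrary integer arc weights `b` on a finite set: the sum
over all listings of the product of `b` along consecutive steps equals the sum over all permutations
of the product, over nontrivial cycles, of `∏ b - ∏ (b - 1)` (`sum_pathWeight_eq_sum_cycleWeight`).
Both sides are affine in each single weight `b (u, w)`, and the slope is the same sum for the set
without `u` and the weights contracted along `(u, w)`. By induction on the set, the difference of
the two sides does not depend on `b`; at `b = 1` both sides are the factorial of the size.

Fix a coloring and let `b` be the indicator of the steps allowed in a friendly listing. The listing
side counts friendly listings, a coefficient of `W_X`. A cycle on which the color varies has a color
descent, where `b = 0`, and an ascent, where `b - 1 = 0`, so its factor vanishes. The remaining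
permutations are those whose cycles are monochromatic, and their weight depends on `X` alone.
Monochromatic cycles are exactly what `p_π` tests, so `W_X` is the sum over permutations `σ` of the
weight of `σ` times `p_π`, with `π` the cycle partition of `σ`. The coefficients are visibly
integers.

In this expansion `∏ (b - 1)` is zero unless the cycle lies in `X`, and then it is `-1` to the
length. Without even cycles in `X` every factor `∏ b - ∏ (b - 1)` is therefore nonnegative. -/

/-- The product, over the nontrivial cycles of a permutation, of the difference of the cycle weights
for the weight function `b` and for `b - 1`. -/
def cycleWeight {α : Type*} [Fintype α] [DecidableEq α] (b : α × α → ℤ) (σ : Equiv.Perm α) : ℤ :=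
  ∏ γ ∈ σ.cycleFactorsFinset,
    (∏ x ∈ γ.support, b (x, γ x) - ∏ x ∈ γ.support, (b (x, γ x) - 1))

/-- The weights after contraction of the arc from `u` to `w`: arcs into `w` now carry the weights of
the arcs into `u`. -/
def contractArc {α : Type*} [DecidableEq α] (b : α × α → ℤ) (u w : α) : α × α → ℤ :=
  fun p => if p.2 = w then b (p.1, u) else b p

theorem prod_sub_one_congr {α : Type*} {s : Finset α} {f g : α → ℤ} (h : ∀ x ∈ s, f x = g x) :
    ∏ x ∈ s, (f x - 1) = ∏ x ∈ s, (g x - 1) :=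
  Finset.prod_congr rfl fun x hx => by rw [h x hx]

/-! ### Deletion-contraction for cycle weights of permutations. -/

section CycleWeight

variable {α : Type*} [Fintype α] [DecidableEq α]

open Equiv Equiv.Perm

theorem cycleWeight_congr {b b' : α × α → ℤ} {σ : Perm α}
    (h : ∀ x ∈ σ.support, b (x, σ x) = b' (x, σ x)) : cycleWeight b σ = cycleWeight b' σ := by
  refine Finset.prod_congr rfl fun γ hγ => ?_
  have key : ∀ x ∈ γ.support, b (x, γ x) = b' (x, γ x) := fun x hx => by
    rw [(mem_cycleFactorsFinset_iff.1 hγ).2 x hx]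
    exact h x (mem_cycleFactorsFinset_support_le hγ hx)
  rw [prod_sub_one_congr key, Finset.prod_congr rfl key]

theorem cycleWeight_one (b : α × α → ℤ) : cycleWeight b (1 : Perm α) = 1 := by
  simp [cycleWeight]

theorem cycleWeight_of_isCycle (b : α × α → ℤ) {γ : Perm α} (hγ : γ.IsCycle) :
    cycleWeight b γ = ∏ x ∈ γ.support, b (x, γ x) - ∏ x ∈ γ.support, (b (x, γ x) - 1) := by
  simp [cycleWeight, hγ.cycleFactorsFinset_eq_singleton]

theorem cycleWeight_mul (b : α × α → ℤ) {σ τ : Perm α} (h : Perm.Disjoint σ τ) :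
    cycleWeight b (σ * τ) = cycleWeight b σ * cycleWeight b τ := by
  rw [cycleWeight, h.cycleFactorsFinset_mul_eq_union,
    Finset.prod_union h.disjoint_cycleFactorsFinset]
  rfl

theorem cycleWeight_const_one (σ : Perm α) : cycleWeight (fun _ => 1) σ = 1 := by
  refine Finset.prod_eq_one fun γ hγ => ?_
  have hc := (mem_cycleFactorsFinset_iff.1 hγ).1
  have : γ.support.card ≠ 0 := by have := hc.two_le_card_support; omega
  simp [this]

theorem cycleWeight_update_of_ne (b : α × α → ℤ) {σ : Perm α} {u w : α} (h : σ u ≠ w ∨ u = w)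
    (s : ℤ) : cycleWeight (Function.update b (u, w) s) σ = cycleWeight b σ := by
  refine cycleWeight_congr fun x hx => Function.update_of_ne ?_ _ _
  rintro he
  obtain ⟨rfl, rfl⟩ := Prod.mk.inj he
  rcases h with h | h
  · exact h rfl
  · exact (mem_support.1 hx) h.symm

/-- The arc leaving `u` occurs once in each of the two products, so the weight is affine in it. The
slope is the weight of the cycle with `u` bypassed: `swap u (γ u) * γ` fixes `u` and sends its
predecessor to `γ u`, and `contractArc` gives that new arc the weight of the old arc into `u`. -/
theorem cycleWeight_update_sub_of_isCycle (b : α × α → ℤ) {γ : Perm α} (hγ : γ.IsCycle) {u : α}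
    (hu : γ u ≠ u) (s t : ℤ) :
    cycleWeight (Function.update b (u, γ u) s) γ - cycleWeight (Function.update b (u, γ u) t) γ =
      (s - t) * cycleWeight (contractArc b u (γ u)) (swap u (γ u) * γ) := by
  have hus : u ∈ γ.support := mem_support.2 hu
  have expand : ∀ r, cycleWeight (Function.update b (u, γ u) r) γ =
      r * ∏ x ∈ γ.support.erase u, b (x, γ x) -
        (r - 1) * ∏ x ∈ γ.support.erase u, (b (x, γ x) - 1) := fun r => by
    rw [cycleWeight_of_isCycle _ hγ, ← Finset.mul_prod_erase _ _ hus,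
      ← Finset.mul_prod_erase _ _ hus]
    have key : ∀ x ∈ γ.support.erase u, Function.update b (u, γ u) r (x, γ x) = b (x, γ x) :=
      fun x hx => Function.update_of_ne (fun h => Finset.ne_of_mem_erase hx (Prod.mk.inj h).1) _ _
    rw [prod_sub_one_congr key, Finset.prod_congr rfl key]
    simp
  have main : cycleWeight (contractArc b u (γ u)) (swap u (γ u) * γ) =
      ∏ x ∈ γ.support.erase u, b (x, γ x) - ∏ x ∈ γ.support.erase u, (b (x, γ x) - 1) := by
    -- A 2-cycle contracts to the identity, of weight 1; this agrees with `b - (b - 1) = 1` for the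
    -- one remaining arc.
    by_cases h2 : γ (γ u) = u
    · have hs := hγ.eq_swap_of_apply_apply_eq_self hu h2
      have h1 : swap u (γ u) * γ = 1 := by
        conv_lhs => rw [hs]
        simp
      have h3 : γ.support.erase u = {γ u} := by
        have : γ.support = {u, γ u} := by
          conv_lhs => rw [hs]
          exact support_swap hu.symm
        rw [this]
        exact Finset.erase_insert (by simpa using hu.symm)
      rw [h1, cycleWeight_one, h3]
      simp
    · rw [cycleWeight_of_isCycle _ (hγ.swap_mul hu h2), support_swap_mul_eq _ _ h2,
        ← Finset.erase_eq]
      have key : ∀ x ∈ γ.support.erase u,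
          contractArc b u (γ u) (x, (swap u (γ u) * γ) x) = b (x, γ x) := fun x hx => by
        have hxu := Finset.ne_of_mem_erase hx
        have h4 : γ x ≠ γ u := fun h => hxu (γ.injective h)
        rw [Perm.mul_apply]
        by_cases h5 : γ x = u
        · simp [contractArc, h5]
        · rw [swap_apply_of_ne_of_ne h5 h4]
          simp [contractArc, h4]
      rw [prod_sub_one_congr key, Finset.prod_congr rfl key]
  rw [expand, expand, main]
  ring

/-- Only the cycle through `u` is affected; the complementary factor `ρ` fixes `u` and `w` and
splits off. -/
theorem cycleWeight_update_sub (b : α × α → ℤ) {σ : Perm α} {u w : α} (hw : σ u = w)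
    (huw : u ≠ w) (s t : ℤ) :
    cycleWeight (Function.update b (u, w) s) σ - cycleWeight (Function.update b (u, w) t) σ =
      (s - t) * cycleWeight (contractArc b u w) (swap u w * σ) := by
  have hus : u ∈ σ.support := mem_support.2 (by rw [hw]; exact huw.symm)
  set γ := σ.cycleOf u with hγdef
  have hmem : γ ∈ σ.cycleFactorsFinset := cycleOf_mem_cycleFactorsFinset_iff.2 hus
  have hγ := (mem_cycleFactorsFinset_iff.1 hmem).1
  have hd := (disjoint_mul_inv_of_mem_cycleFactorsFinset hmem).symm
  set ρ := σ * γ⁻¹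
  have hγu : γ u = w := by rw [hγdef, cycleOf_apply_self, hw]
  have hσ : σ = γ * ρ := by rw [hd.commute.eq]; simp [ρ]
  have hργu : ρ u = u := by
    rcases hd u with h | h
    · exact absurd (hγu.symm.trans h) huw.symm
    · exact h
  have hργw : ρ w = w := by
    rcases hd w with h | h
    · exact absurd (γ.injective (h.trans hγu.symm)) huw.symm
    · exact h
  have hd' : Perm.Disjoint (swap u w * γ) ρ := fun x => by
    rcases hd x with h | h
    · by_cases hxu : x = u
      · right; rw [hxu, hργu]
      · by_cases hxw : x = w
        · right; rw [hxw, hργw]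
        · left; rw [Perm.mul_apply, h, swap_apply_of_ne_of_ne hxu hxw]
    · exact Or.inr h
  have hup : ∀ r, cycleWeight (Function.update b (u, w) r) ρ = cycleWeight b ρ := fun r =>
    cycleWeight_update_of_ne b (Or.inl (by rw [hργu]; exact huw)) r
  have hcon : cycleWeight (contractArc b u w) ρ = cycleWeight b ρ :=
    cycleWeight_congr fun x hx => by
      have : ρ x ≠ w := fun h => (mem_support.1 hx) (by
        have := ρ.injective (h.trans hργw.symm)
        rw [this, hργw])
      simp [contractArc, this]
  have hc := cycleWeight_update_sub_of_isCycle b hγ (u := u) (by rw [hγu]; exact huw.symm) s t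
  rw [hγu] at hc
  rw [hσ, cycleWeight_mul _ hd, cycleWeight_mul _ hd, ← mul_assoc (swap u w), cycleWeight_mul _ hd',
    hup, hup, hcon, ← sub_mul, hc]
  ring

/-- Deletion-contraction for the sum of the cycle weights of the permutations of a finite set. -/
theorem sum_cycleWeight_update_sub (b : α × α → ℤ) {A : Finset α} {u w : α} (hu : u ∈ A)
    (hw : w ∈ A) (huw : u ≠ w) (s t : ℤ) :
    ∑ σ ∈ permsOfFinset A, cycleWeight (Function.update b (u, w) s) σ -
        ∑ σ ∈ permsOfFinset A, cycleWeight (Function.update b (u, w) t) σ =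
      (s - t) * ∑ σ ∈ permsOfFinset (A.erase u), cycleWeight (contractArc b u w) σ := by
  rw [← Finset.sum_sub_distrib,
    ← Finset.sum_filter_add_sum_filter_not (permsOfFinset A) (fun σ => σ u = w),
    Finset.sum_eq_zero (s := (permsOfFinset A).filter fun σ => ¬ σ u = w), add_zero, Finset.mul_sum]
  -- Left multiplication by the swap is an involution exchanging the condition `σ u = w` with `σ u =
  -- u`.
  · refine Finset.sum_bij' (fun σ _ => swap u w * σ) (fun σ _ => swap u w * σ) ?_ ?_ ?_ ?_ ?_
    · intro σ hσ
      rw [Finset.mem_filter, mem_perms_of_finset_iff] at hσ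
      rw [mem_perms_of_finset_iff]
      intro x hx
      have hxu : x ≠ u := by
        rintro rfl
        exact hx (by rw [Perm.mul_apply, hσ.2, swap_apply_right])
      refine Finset.mem_erase.2 ⟨hxu, ?_⟩
      by_cases hxw : x = w
      · rwa [hxw]
      · exact hσ.1 fun h => hx (by rw [Perm.mul_apply, h, swap_apply_of_ne_of_ne hxu hxw])
    · intro σ hσ
      rw [mem_perms_of_finset_iff] at hσ
      have hσu : σ u = u := by
        by_contra h
        exact Finset.notMem_erase u A (hσ h)
      rw [Finset.mem_filter, mem_perms_of_finset_iff]
      refine ⟨fun {x} hx => ?_, by rw [Perm.mul_apply, hσu, swap_apply_left]⟩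
      by_cases hxu : x = u
      · rwa [hxu]
      by_cases hxw : x = w
      · rwa [hxw]
      · exact Finset.mem_of_mem_erase
          (hσ fun h => hx (by rw [Perm.mul_apply, h, swap_apply_of_ne_of_ne hxu hxw]))
    · intro σ _; simp
    · intro σ _; simp
    · intro σ hσ
      exact cycleWeight_update_sub b (Finset.mem_filter.1 hσ).2 huw s t
  · intro σ hσ
    rw [cycleWeight_update_of_ne _ (Or.inl (Finset.mem_filter.1 hσ).2),
      cycleWeight_update_of_ne _ (Or.inl (Finset.mem_filter.1 hσ).2), sub_self]

theorem sum_cycleWeight_update_of_forall (b : α × α → ℤ) {A : Finset α} {u w : α}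
    (h : u ∉ A ∨ w ∉ A ∨ u = w) (s : ℤ) :
    ∑ σ ∈ permsOfFinset A, cycleWeight (Function.update b (u, w) s) σ =
      ∑ σ ∈ permsOfFinset A, cycleWeight b σ := by
  refine Finset.sum_congr rfl fun σ hσ => cycleWeight_update_of_ne b ?_ s
  rw [mem_perms_of_finset_iff] at hσ
  by_contra! h'
  obtain ⟨h1, h2⟩ := h'
  rcases h with h | h | h
  · exact h (hσ (by rw [h1]; exact h2.symm))
  · exact h (hσ fun h3 => h2 (σ.injective (h1.trans h3.symm)))
  · exact h2 h

end CycleWeight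

/-! ### Deletion-contraction for path weights of listings. -/

/-- The product of the weights of the steps of a list. -/
def pathWeight {α : Type*} (b : α × α → ℤ) : List α → ℤ
  | [] => 1
  | [_] => 1
  | x :: y :: l => b (x, y) * pathWeight b (y :: l)

theorem pathWeight_const_one {α : Type*} (l : List α) : pathWeight (fun _ => 1) l = 1 := by
  induction l using List.twoStepInduction with
  | nil => rfl
  | singleton x => rfl
  | cons_cons x y l _ ih => simp [pathWeight, ih]

theorem pathWeight_indicator {α : Type*} (R : α → α → Prop) [DecidableRel R] (l : List α) :
    pathWeight (fun p => if R p.1 p.2 then 1 else 0) l = if l.IsChain R then 1 else 0 := by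
  induction l using List.twoStepInduction with
  | nil => simp [pathWeight]
  | singleton x => simp [pathWeight]
  | cons_cons x y l _ ih =>
    by_cases h : R x y <;> simp [h, pathWeight, ih]

section PathWeight

variable {α : Type*} [DecidableEq α]

theorem pathWeight_update_of_not_infix (b : α × α → ℤ) {u w : α} {l : List α}
    (h : ¬ [u, w] <:+: l) (s : ℤ) : pathWeight (Function.update b (u, w) s) l = pathWeight b l := by
  induction l using List.twoStepInduction with
  | nil => rfl
  | singleton x => rfl
  | cons_cons x y l _ ih =>
    rw [pathWeight, pathWeight, ih y fun h' => h (h'.trans (List.suffix_cons x _).isInfix),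
      Function.update_of_ne]
    intro he
    obtain ⟨rfl, rfl⟩ := Prod.mk.inj he
    exact h ⟨[], l, rfl⟩

/-- Insert `u` in front of every occurrence of `w`. -/
def insertBefore (u w : α) (l : List α) : List α :=
  l.flatMap fun x => if x = w then [u, w] else [x]

theorem insertBefore_of_notMem {u w : α} {l : List α} (h : w ∉ l) : insertBefore u w l = l := by
  induction l with
  | nil => rfl
  | cons x l ih =>
    have hx : x ≠ w := fun e => h (e ▸ List.mem_cons_self)
    have := ih fun e => h (List.mem_cons_of_mem x e)
    rw [insertBefore] at this ⊢
    rw [List.flatMap_cons, if_neg hx, this, List.singleton_append]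

theorem insertBefore_append_cons {u w : α} {l₁ l₂ : List α} (h₁ : w ∉ l₁) (h₂ : w ∉ l₂) :
    insertBefore u w (l₁ ++ w :: l₂) = l₁ ++ u :: w :: l₂ := by
  have e₁ := insertBefore_of_notMem (u := u) h₁
  have e₂ := insertBefore_of_notMem (u := u) h₂
  rw [insertBefore] at e₁ e₂ ⊢
  rw [List.flatMap_append, List.flatMap_cons, e₁, e₂, if_pos rfl]
  rfl

/-- Contraction alters only arcs into `w`, and no step enters the head `x`, which may itself be `w`.
-/
theorem pathWeight_contractArc_of_notMem (b : α × α → ℤ) {u w x : α} {l : List α} (h : w ∉ l) :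
    pathWeight (contractArc b u w) (x :: l) = pathWeight b (x :: l) := by
  induction l generalizing x with
  | nil => rfl
  | cons y l ih =>
    rw [pathWeight, pathWeight, ih fun e => h (List.mem_cons_of_mem y e), contractArc,
      if_neg fun e : y = w => h (e ▸ List.mem_cons_self)]

theorem pathWeight_update_append_cons_cons (b : α × α → ℤ) {u w : α} {l₁ l₂ : List α}
    (h : (l₁ ++ u :: w :: l₂).Nodup) (s : ℤ) :
    pathWeight (Function.update b (u, w) s) (l₁ ++ u :: w :: l₂) =
      s * pathWeight (contractArc b u w) (l₁ ++ w :: l₂) := by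
  induction l₁ using List.twoStepInduction with
  | nil =>
    simp only [List.nil_append, List.nodup_cons] at h ⊢
    rw [pathWeight, Function.update_self, pathWeight_contractArc_of_notMem _ h.2.1,
      pathWeight_update_of_not_infix]
    exact fun h' => h.1 (h'.subset List.mem_cons_self)
  | singleton x =>
    simp only [List.cons_append, List.nil_append, List.nodup_cons, List.mem_cons, not_or] at h ⊢
    rw [pathWeight, pathWeight, pathWeight, Function.update_self,
      pathWeight_contractArc_of_notMem _ h.2.2.1, pathWeight_update_of_not_infix,
      Function.update_of_ne (by simp [h.1.1]), contractArc, if_pos rfl]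
    · ring
    · exact fun h' => by simpa [h.2.1] using h'.subset List.mem_cons_self
  | cons_cons x y l _ ih =>
    have h' := ih y (by simp only [List.cons_append, List.nodup_cons] at h ⊢; exact h.2)
    simp only [List.cons_append] at h h' ⊢
    have hx := (List.nodup_cons.1 h).1
    have hy := (List.nodup_cons.1 (List.nodup_cons.1 h).2).1
    have hxu : x ≠ u := fun e => hx (by simp [e])
    have hyw : y ≠ w := fun e => hy (by simp [e])
    rw [pathWeight, pathWeight, h', Function.update_of_ne (by simp [hxu]), contractArc, if_neg hyw]
    ring

theorem sum_pathWeight_update_of_not_infix (b : α × α → ℤ) {A : Finset α} {u w : α}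
    (h : u ∉ A ∨ w ∉ A ∨ u = w) (s : ℤ) :
    ∑ l ∈ A.toList.permutations.toFinset, pathWeight (Function.update b (u, w) s) l =
      ∑ l ∈ A.toList.permutations.toFinset, pathWeight b l := by
  refine Finset.sum_congr rfl fun l hl => pathWeight_update_of_not_infix b ?_ s
  rw [List.mem_toFinset, List.mem_permutations] at hl
  intro h'
  have hu : u ∈ A := by simpa using hl.subset (h'.subset List.mem_cons_self)
  have hw : w ∈ A := by simpa using hl.subset (h'.subset (by simp : w ∈ [u, w]))
  rcases h with h | h | h
  · exact h hu
  · exact h hw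
  · subst h
    have := h'.sublist.nodup (hl.nodup_iff.2 A.nodup_toList)
    simp at this

/-- Deletion-contraction for the sum of the path weights of the listings of a finite set. -/
theorem sum_pathWeight_update_sub (b : α × α → ℤ) {A : Finset α} {u w : α} (hu : u ∈ A)
    (hw : w ∈ A) (huw : u ≠ w) (s t : ℤ) :
    ∑ l ∈ A.toList.permutations.toFinset, pathWeight (Function.update b (u, w) s) l -
        ∑ l ∈ A.toList.permutations.toFinset, pathWeight (Function.update b (u, w) t) l =
      (s - t) * ∑ l ∈ (A.erase u).toList.permutations.toFinset,
        pathWeight (contractArc b u w) l := by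
  have hmem : ∀ (B : Finset α) (l : List α),
      l ∈ B.toList.permutations.toFinset ↔ l.Nodup ∧ ∀ x, x ∈ l ↔ x ∈ B := fun B l => by
    rw [List.mem_toFinset, List.mem_permutations]
    constructor
    · intro h
      exact ⟨h.nodup_iff.2 B.nodup_toList, fun x => by rw [h.mem_iff, Finset.mem_toList]⟩
    · rintro ⟨h1, h2⟩
      exact (List.perm_ext_iff_of_nodup h1 B.nodup_toList).2 fun x => by
        rw [h2, Finset.mem_toList]
  rw [← Finset.sum_sub_distrib,
    ← Finset.sum_filter_add_sum_filter_not _ (fun l => [u, w] <:+: l),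
    Finset.sum_eq_zero (s := (A.toList.permutations.toFinset).filter fun l => ¬ [u, w] <:+: l),
    add_zero, Finset.mul_sum]
  · have hleft : ∀ l ∈ A.toList.permutations.toFinset.filter fun l => [u, w] <:+: l,
        ∃ l₁ l₂, l = l₁ ++ u :: w :: l₂ ∧ l.erase u = l₁ ++ w :: l₂ ∧
          insertBefore u w (l₁ ++ w :: l₂) = l := fun l hl => by
      rw [Finset.mem_filter, hmem] at hl
      obtain ⟨⟨hn, -⟩, l₁, l₂, rfl⟩ := hl
      simp only [List.append_assoc, List.cons_append, List.nil_append] at hn ⊢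
      have hn' := hn
      rw [List.nodup_append'] at hn'
      obtain ⟨-, h2, h3⟩ := hn'
      have hu1 : u ∉ l₁ := fun h => h3 h (by simp)
      have hw1 : w ∉ l₁ := fun h => h3 h (by simp)
      have hw2 : w ∉ l₂ := (List.nodup_cons.1 (List.nodup_cons.1 h2).2).1
      exact ⟨l₁, l₂, rfl, by rw [List.erase_append_right _ hu1, List.erase_cons_head],
        insertBefore_append_cons hw1 hw2⟩
    have hright : ∀ l ∈ (A.erase u).toList.permutations.toFinset,
        ∃ l₁ l₂, l = l₁ ++ w :: l₂ ∧ insertBefore u w l = l₁ ++ u :: w :: l₂ ∧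
          u ∉ l₁ ∧ u ∉ l₂ := fun l hl => by
      rw [hmem] at hl
      obtain ⟨l₁, l₂, rfl⟩ := List.append_of_mem ((hl.2 w).2 (Finset.mem_erase.2 ⟨huw.symm, hw⟩))
      have hn := hl.1
      rw [List.nodup_append'] at hn
      obtain ⟨-, h2, h3⟩ := hn
      have hu' : u ∉ l₁ ++ w :: l₂ := fun h => Finset.notMem_erase u A ((hl.2 u).1 h)
      simp only [List.mem_append, List.mem_cons, not_or] at hu'
      exact ⟨l₁, l₂, rfl, insertBefore_append_cons (fun h => h3 h (by simp))
        (List.nodup_cons.1 h2).1, hu'.1, hu'.2.2⟩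
    -- Listings of `A` with `u` directly before `w` correspond to listings of `A.erase u`.
    refine Finset.sum_bij' (fun l _ => l.erase u) (fun l _ => insertBefore u w l) ?_ ?_ ?_ ?_ ?_
    · intro l hl
      rw [Finset.mem_filter, hmem] at hl
      rw [hmem]
      refine ⟨hl.1.1.erase u, fun x => ?_⟩
      rw [hl.1.1.mem_erase_iff, Finset.mem_erase, hl.1.2]
    · intro l hl
      obtain ⟨l₁, l₂, rfl, h2, h3, h4⟩ := hright l hl
      rw [hmem] at hl
      rw [h2, Finset.mem_filter, hmem]
      refine ⟨⟨?_, fun x => ?_⟩, l₁, l₂, by simp⟩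
      · rw [(List.perm_middle (l₂ := w :: l₂)).nodup_iff, List.nodup_cons]
        exact ⟨fun h => Finset.notMem_erase u A ((hl.2 u).1 h), hl.1⟩
      · rw [(List.perm_middle (l₂ := w :: l₂)).mem_iff, List.mem_cons, hl.2, Finset.mem_erase]
        by_cases hx : x = u <;> simp [hx, hu]
    · intro l hl
      obtain ⟨l₁, l₂, h1, h2, h3⟩ := hleft l hl
      simp only [h2, h3]
    · intro l hl
      obtain ⟨l₁, l₂, h1, h2, h3, h4⟩ := hright l hl
      rw [h2, List.erase_append_right _ h3, List.erase_cons_head, h1]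
    · intro l hl
      obtain ⟨l₁, l₂, h1, h2, h3⟩ := hleft l hl
      have hn := ((hmem _ _).1 (Finset.mem_filter.1 hl).1).1
      rw [h2]
      rw [h1] at hn ⊢
      rw [pathWeight_update_append_cons_cons _ hn, pathWeight_update_append_cons_cons _ hn, sub_mul]
  · intro l hl
    rw [pathWeight_update_of_not_infix _ (Finset.mem_filter.1 hl).2,
      pathWeight_update_of_not_infix _ (Finset.mem_filter.1 hl).2, sub_self]

end PathWeight

/-! ### Equality of the path sum and the cycle sum. -/

theorem eq_of_forall_update_eq {ι β γ : Type*} [Fintype ι] [DecidableEq ι] (D : (ι → β) → γ)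
    (h : ∀ b i s, D (Function.update b i s) = D b) (b c : ι → β) : D b = D c := by
  have key : ∀ S : Finset ι, D (S.piecewise c b) = D b := fun S => by
    induction S using Finset.induction_on with
    | empty => simp
    | insert i S _ ih => rw [Finset.piecewise_insert, h, ih]
  simpa using (key Finset.univ).symm

/-- The sum of the path weights of the listings of a finite set is the sum of the cycle weights of
its permutations. -/
theorem sum_pathWeight_eq_sum_cycleWeight {α : Type*} [Fintype α] [DecidableEq α] (A : Finset α)
    (b : α × α → ℤ) :
    ∑ l ∈ A.toList.permutations.toFinset, pathWeight b l =
      ∑ σ ∈ permsOfFinset A, cycleWeight b σ := by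
  induction A using Finset.strongInduction generalizing b with
  | H A ih =>
    rw [← sub_eq_zero, eq_of_forall_update_eq (fun b =>
      ∑ l ∈ A.toList.permutations.toFinset, pathWeight b l -
        ∑ σ ∈ permsOfFinset A, cycleWeight b σ) ?_ b (fun _ => 1)]
    · simp only [pathWeight_const_one, cycleWeight_const_one, Finset.sum_const,
        card_perms_of_finset]
      rw [List.toFinset_card_of_nodup (List.nodup_permutations _ A.nodup_toList),
        List.length_permutations, Finset.length_toList, sub_self]
    · rintro b ⟨u, w⟩ s
      by_cases h : u ∉ A ∨ w ∉ A ∨ u = w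
      · simp only [sum_pathWeight_update_of_not_infix b h, sum_cycleWeight_update_of_forall b h]
      · push Not at h
        -- Changing one weight moves both sums by the same multiple of sums over `A.erase u`, which
        -- agree by induction.
        have h1 := sum_pathWeight_update_sub b h.1 h.2.1 h.2.2 s (b (u, w))
        have h2 := sum_cycleWeight_update_sub b h.1 h.2.1 h.2.2 s (b (u, w))
        rw [← ih _ (Finset.erase_ssubset h.1)] at h2
        rw [Function.update_eq_self] at h1 h2
        linarith

/-! ### Weights coming from a relation and a coloring. -/

/-- Since `f` and `f ∘ γ` have equal sums, `f ≤ f ∘ γ` everywhere would force equality. Used with a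
color and with its negative, this yields both a descent and an ascent. -/
theorem Equiv.Perm.exists_apply_lt {α : Type*} [Fintype α] (γ : Equiv.Perm α) (f : α → ℤ) {x : α}
    (h : f (γ x) ≠ f x) : ∃ y, f (γ y) < f y := by
  by_contra! h'
  exact h ((Finset.sum_eq_sum_iff_of_le fun y _ => h' y).1 (Equiv.sum_comp γ f).symm x
    (Finset.mem_univ x)).symm

open Classical in
/-- The indicator function of the pairs that are not related. -/
noncomputable def nonArc {α : Type*} (r : α → α → Prop) : α × α → ℤ :=
  fun p => if ¬ r p.1 p.2 then 1 else 0

/-- The relation between two vertices that may not be consecutive in a listing that is friendly for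
the coloring `f`. -/
def friendlyObstruction {α : Type*} (r : α → α → Prop) (f : α → ℕ+) (x y : α) : Prop :=
  f y < f x ∨ f x = f y ∧ r x y

section NonArc

variable {α : Type*} [Fintype α] [DecidableEq α]

open Equiv Equiv.Perm

theorem cycleWeight_friendlyObstruction_of_forall (r : α → α → Prop) {f : α → ℕ+} {σ : Perm α}
    (h : ∀ x, f (σ x) = f x) :
    cycleWeight (nonArc (friendlyObstruction r f)) σ = cycleWeight (nonArc r) σ :=
  cycleWeight_congr fun x _ => by
    have : friendlyObstruction r f x (σ x) ↔ r x (σ x) := by simp [friendlyObstruction, h x]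
    by_cases hr : r x (σ x)
    · simp [nonArc, this.2 hr, hr]
    · simp [nonArc, mt this.1 hr, hr]

/-- On a cycle with varying color, a descent makes the first product zero and an ascent the second.
-/
theorem cycleWeight_friendlyObstruction_of_exists (r : α → α → Prop) {f : α → ℕ+} {σ : Perm α}
    (h : ∃ x, f (σ x) ≠ f x) : cycleWeight (nonArc (friendlyObstruction r f)) σ = 0 := by
  obtain ⟨x, hx⟩ := h
  have hxs : x ∈ σ.support := mem_support.2 fun h => hx (by rw [h])
  refine Finset.prod_eq_zero (cycleOf_mem_cycleFactorsFinset_iff.2 hxs) ?_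
  have hx' : f (σ.cycleOf x x) ≠ f x := by rwa [cycleOf_apply_self]
  obtain ⟨y, hy⟩ := (σ.cycleOf x).exists_apply_lt (fun y => ((f y : ℕ) : ℤ)) (x := x)
    (by simpa using hx')
  obtain ⟨z, hz⟩ := (σ.cycleOf x).exists_apply_lt (fun y => -((f y : ℕ) : ℤ)) (x := x)
    (by simpa using hx')
  replace hy : f (σ.cycleOf x y) < f y := by simpa using hy
  replace hz : f z < f (σ.cycleOf x z) := by simpa using hz
  have hys : y ∈ (σ.cycleOf x).support := mem_support.2 fun h => hy.ne (by rw [h])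
  have hzs : z ∈ (σ.cycleOf x).support := mem_support.2 fun h => hz.ne (by rw [h])
  rw [Finset.prod_eq_zero hys, Finset.prod_eq_zero hzs, sub_self]
  · simp [nonArc, friendlyObstruction, hz.le, hz.ne]
  · simp [nonArc, friendlyObstruction, hy]

theorem cycleWeight_nonArc_nonneg {r : α → α → Prop}
    (h : ∀ γ : Perm α, γ.IsCycle → (∀ x ∈ γ.support, r x (γ x)) → Odd γ.support.card)
    (σ : Perm α) : 0 ≤ cycleWeight (nonArc r) σ := by
  refine Finset.prod_nonneg fun γ hγ => ?_
  have hc := (mem_cycleFactorsFinset_iff.1 hγ).1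
  have h0 : 0 ≤ ∏ x ∈ γ.support, nonArc r (x, γ x) :=
    Finset.prod_nonneg fun x _ => by unfold nonArc; split_ifs <;> simp
  suffices h1 : ∏ x ∈ γ.support, (nonArc r (x, γ x) - 1) ≤ 0 by linarith
  by_cases ha : ∀ x ∈ γ.support, r x (γ x)
  · rw [Finset.prod_congr rfl fun x hx =>
      show nonArc r (x, γ x) - 1 = -1 by simp [nonArc, ha x hx], Finset.prod_const,
      (h γ hc ha).neg_one_pow]
    norm_num
  · push Not at ha
    obtain ⟨x, hx, hr⟩ := ha
    rw [Finset.prod_eq_zero hx]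
    simp [nonArc, hr]

theorem sum_pathWeight_friendlyObstruction (r : α → α → Prop) (f : α → ℕ+) :
    ∑ l ∈ (Finset.univ : Finset α).toList.permutations.toFinset,
        pathWeight (nonArc (friendlyObstruction r f)) l =
      ∑ σ : Perm α, if ∀ x, f (σ x) = f x then cycleWeight (nonArc r) σ else 0 := by
  have hu : permsOfFinset (Finset.univ : Finset α) = Finset.univ := by
    ext σ
    simp [mem_perms_of_finset_iff]
  rw [sum_pathWeight_eq_sum_cycleWeight, hu]
  refine Finset.sum_congr rfl fun σ _ => ?_
  split_ifs with h
  · exact cycleWeight_friendlyObstruction_of_forall r h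
  · exact cycleWeight_friendlyObstruction_of_exists r (not_forall.1 h)

end NonArc

/-! ### Coefficients of formal sums of words. -/

theorem List.exists_ofFn_eq {β : Type*} {m : ℕ} (l : List β) (h : l.length = m) :
    ∃ g : Fin m → β, List.ofFn g = l := by
  subst h
  exact ⟨l.get, List.ofFn_get l⟩

theorem NCSeries.word_injective {n : ℕ} :
    Function.Injective (NCSeries.word : (Fin n → ℕ+) → FreeMonoid ℕ+) :=
  fun _ _ h => List.ofFn_injective (FreeMonoid.ofList.injective h)

theorem NCSeries.exists_word_eq {n : ℕ} {w : FreeMonoid ℕ+} (h : w.toList.length = n) :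
    ∃ i : Fin n → ℕ+, NCSeries.word i = w := by
  obtain ⟨i, hi⟩ := List.exists_ofFn_eq w.toList h
  exact ⟨i, by rw [NCSeries.word, hi, FreeMonoid.ofList_toList]⟩

theorem NCSeries.length_toList_word {n : ℕ} (i : Fin n → ℕ+) :
    (NCSeries.word i).toList.length = n := by
  simp [NCSeries.word]

theorem NCSeries.formalSum_eq_zero {ι : Type*} {t : ι → FreeMonoid ℕ+} {w : FreeMonoid ℕ+}
    (h : ∀ a, t a ≠ w) : NCSeries.formalSum t w = 0 := by
  have : IsEmpty {a : ι // t a = w} := ⟨fun a => h a.1 a.2⟩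
  simp [NCSeries.formalSum]

theorem NCSeries.formalSum_subtype_word {n : ℕ} (P : (Fin n → ℕ+) → Prop) (i : Fin n → ℕ+)
    [Decidable (P i)] :
    NCSeries.formalSum (fun j : {j // P j} => NCSeries.word j.1) (NCSeries.word i) =
      if P i then 1 else 0 := by
  split_ifs with h
  · have : Unique {a : {j // P j} // NCSeries.word a.1 = NCSeries.word i} :=
      { default := ⟨⟨i, h⟩, rfl⟩
        uniq := fun a => Subtype.ext (Subtype.ext (NCSeries.word_injective a.2)) }
    simp [NCSeries.formalSum]
  · refine NCSeries.formalSum_eq_zero fun a ha => h ?_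
    rw [← NCSeries.word_injective ha]
    exact a.2

/-! ### Coefficients of the Redei-Berge function and cycles of the digraph. -/

namespace Digraph

variable {V : Type*} {n : ℕ} (X : Digraph V) (v : Fin n ≃ V)

theorem friendly_iff_isChain (i : Fin n → ℕ+) (σ : Fin n ≃ V) :
    X.Friendly (fun x => i (v.symm x)) σ ↔
      (List.ofFn fun j => v.symm (σ j)).IsChain
        (fun j k => ¬ friendlyObstruction (fun a b => X.Adj (v a) (v b)) i j k) := by
  simp only [List.isChain_ofFn, Friendly, friendlyObstruction, ← forall_and,
    Equiv.apply_symm_apply, not_or, not_lt, not_and]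
  refine forall_congr' fun j => forall_congr' fun h => and_congr_right fun hle => ?_
  constructor
  · exact fun h1 h2 h3 => (h1 h3).ne h2
  · exact fun h1 h2 => lt_of_le_of_ne hle fun h3 => h1 h3 h2

-- The path sum for `friendlyObstruction` has 0-1 terms and counts the friendly listings,
-- transported to `Fin n` by `v`.
open Classical in
theorem redeiBerge_word (i : Fin n → ℕ+) :
    X.redeiBerge v (NCSeries.word i) =
      ((∑ σ : Equiv.Perm (Fin n), if ∀ j, i (σ j) = i j then
        cycleWeight (nonArc fun a b => X.Adj (v a) (v b)) σ else 0 : ℤ) : ℂ) := by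
  refine Eq.trans ?_ (congrArg (Int.cast (R := ℂ)) ((sum_pathWeight_friendlyObstruction
    (fun a b => X.Adj (v a) (v b)) i).trans (Finset.sum_congr rfl fun σ _ => by congr)))
  unfold nonArc
  rw [Finset.sum_congr rfl fun l _ => pathWeight_indicator
    (fun j k => ¬ friendlyObstruction (fun a b => X.Adj (v a) (v b)) i j k) l, Finset.sum_boole]
  rw [redeiBerge, NCSeries.formalSum, Int.cast_natCast, ← Fintype.card_coe,
    ← Nat.card_eq_fintype_card]
  congr 1
  -- The word determines the coloring, so only the listing remains free.
  have hf : ∀ a : {a : {a : (V → ℕ+) × (Fin n ≃ V) // X.Friendly a.1 a.2} //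
      NCSeries.word (fun k => a.1.1 (v k)) = NCSeries.word i},
      a.1.1.1 = fun x => i (v.symm x) := fun a => by
    funext x
    have := congrFun (NCSeries.word_injective a.2) (v.symm x)
    simpa using this
  refine Nat.card_congr (Equiv.ofBijective
    (fun a => ⟨List.ofFn fun j => v.symm (a.1.1.2 j), ?_⟩) ⟨?_, ?_⟩)
  · rw [Finset.mem_filter, List.mem_toFinset, List.mem_permutations]
    refine ⟨?_, (friendly_iff_isChain X v i _).1 (hf a ▸ a.1.2)⟩
    refine (List.perm_ext_iff_of_nodup (List.nodup_ofFn.2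
      (v.symm.injective.comp a.1.1.2.injective)) (Finset.nodup_toList _)).2 fun x => ?_
    simp only [List.mem_ofFn, Finset.mem_toList, Finset.mem_univ, iff_true]
    exact ⟨a.1.1.2.symm (v x), by simp⟩
  · intro a a' h
    have h1 := List.ofFn_injective (Subtype.mk.inj h)
    refine Subtype.ext (Subtype.ext (Prod.ext ((hf a).trans (hf a').symm) ?_))
    exact Equiv.ext fun j => v.symm.injective (congrFun h1 j)
  · rintro ⟨l, hl⟩
    rw [Finset.mem_filter, List.mem_toFinset, List.mem_permutations] at hl
    obtain ⟨g, rfl⟩ := List.exists_ofFn_eq (m := n) l (by simp [hl.1.length_eq])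
    have hg : Function.Injective g :=
      List.nodup_ofFn.1 (hl.1.nodup_iff.2 (Finset.nodup_toList _))
    set σ : Fin n ≃ V := (Equiv.ofBijective g (Finite.injective_iff_bijective.1 hg)).trans v
    have hσ : (fun j => v.symm (σ j)) = g := by
      funext j
      simp [σ]
    refine ⟨⟨⟨(fun x => i (v.symm x), σ), ?_⟩, ?_⟩, ?_⟩
    · rw [friendly_iff_isChain, hσ]
      exact hl.2
    · simp
    · exact Subtype.ext (congrArg List.ofFn hσ)

/-- The orbit `x, γ x, γ² x, …` of a moved point traces a directed cycle of `X` whose length is the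
size of the support. -/
theorem odd_card_support_of_isCycle (h : ∀ k : ℕ, Even k → ¬ X.HasCycleOfLength k)
    {γ : Equiv.Perm (Fin n)} (hγ : γ.IsCycle) (ha : ∀ x ∈ γ.support, X.Adj (v x) (v (γ x))) :
    Odd γ.support.card := by
  rw [← Nat.not_even_iff_odd]
  intro he
  refine h _ he ⟨by have := hγ.two_le_card_support; omega, ?_⟩
  obtain ⟨x, hx⟩ := hγ.nonempty_support
  have hon : γ.IsCycleOn (γ.support : Set (Fin n)) := by
    simpa [Equiv.Perm.coe_support_eq_set_support] using hγ.isCycleOn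
  have hpow : ∀ {a b : ℕ}, (γ ^ a) x = (γ ^ b) x ↔ a ≡ b [MOD γ.support.card] :=
    hon.pow_apply_eq_pow_apply hx
  refine ⟨fun j => v ((γ ^ (j : ℕ)) x), fun j k hjk => ?_, fun j => ?_⟩
  · exact Fin.ext (Nat.ModEq.eq_of_lt_of_lt (hpow.1 (v.injective hjk)) j.2 k.2)
  · have : NeZero γ.support.card := j.neZero
    -- The wrap-around of `finRotate` is harmless because exponents matter only modulo the cycle
    -- length.
    have h1 : (γ ^ (finRotate _ j : ℕ)) x = γ ((γ ^ (j : ℕ)) x) := by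
      rw [← Equiv.Perm.mul_apply, ← pow_succ', hpow, finRotate_apply, Fin.val_add, Fin.val_one']
      simp [Nat.ModEq]
    change X.Adj (v ((γ ^ (j : ℕ)) x)) (v ((γ ^ (finRotate _ j : ℕ)) x))
    rw [h1]
    exact ha _ (Equiv.Perm.pow_apply_mem_support.2 hx)

end Digraph

/-! ### Monomial and power sum functions: evaluation and independence. -/

namespace SetPartition

variable {n : ℕ}

theorem sameBlock_iff_mem_part {π : SetPartition n} {j k : Fin n} :
    π.SameBlock j k ↔ j ∈ π.part k :=
  (Finpartition.mem_part_iff_exists _).symm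

theorem sameBlock_iff_part_eq {π : SetPartition n} {j k : Fin n} :
    π.SameBlock j k ↔ π.part j = π.part k := by
  rw [sameBlock_iff_mem_part, Finpartition.mem_part_iff_part_eq_part _ (Finset.mem_univ _)
    (Finset.mem_univ _)]

theorem le_iff_sameBlock {π ρ : SetPartition n} :
    π ≤ ρ ↔ ∀ j k, π.SameBlock j k → ρ.SameBlock j k := by
  constructor
  · rintro h j k ⟨B, hB, hj, hk⟩
    obtain ⟨C, hC, hBC⟩ := h hB
    exact ⟨C, hC, hBC hj, hBC hk⟩
  · intro h B hB
    obtain ⟨j, hj⟩ := π.nonempty_of_mem_parts hB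
    refine ⟨ρ.part j, ρ.part_mem.2 (Finset.mem_univ j), fun k hk => ?_⟩
    exact sameBlock_iff_mem_part.1 (h k j ⟨B, hB, hk, hj⟩)

theorem ext_sameBlock {π ρ : SetPartition n} (h : ∀ j k, π.SameBlock j k ↔ ρ.SameBlock j k) :
    π = ρ :=
  le_antisymm (le_iff_sameBlock.2 fun j k => (h j k).1) (le_iff_sameBlock.2 fun j k => (h j k).2)

open Classical in
/-- The partition of the positions into the classes of an equivalence relation. -/
noncomputable def ofRel (s : Setoid (Fin n)) : SetPartition n :=
  Finpartition.ofSetoid s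

theorem sameBlock_ofRel {s : Setoid (Fin n)} {j k : Fin n} : (ofRel s).SameBlock j k ↔ s j k := by
  classical
  rw [sameBlock_iff_mem_part, ofRel, Finpartition.mem_part_ofSetoid_iff_rel]
  exact ⟨s.symm, s.symm⟩

/-- A sequence that takes equal values exactly at positions in the same block. -/
noncomputable def canonicalSeq (π : SetPartition n) (j : Fin n) : ℕ+ :=
  (Fintype.equivFin (Finset (Fin n)) (π.part j) : ℕ).succPNat

theorem canonicalSeq_eq_iff {π : SetPartition n} {j k : Fin n} :
    π.canonicalSeq j = π.canonicalSeq k ↔ π.SameBlock j k := by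
  rw [sameBlock_iff_part_eq, canonicalSeq, canonicalSeq, Nat.succPNat_inj, Fin.val_inj,
    Equiv.apply_eq_iff_eq]

open Classical in
theorem powerSum_word (π : SetPartition n) (i : Fin n → ℕ+) :
    π.powerSum (NCSeries.word i) = if ∀ j k, π.SameBlock j k → i j = i k then 1 else 0 :=
  NCSeries.formalSum_subtype_word _ i

open Classical in
theorem powerSum_canonicalSeq (π ρ : SetPartition n) :
    π.powerSum (NCSeries.word ρ.canonicalSeq) = if π ≤ ρ then 1 else 0 := by
  rw [powerSum_word]
  simp only [canonicalSeq_eq_iff, le_iff_sameBlock]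

open Classical in
theorem monomialSymm_word (π : SetPartition n) (i : Fin n → ℕ+) :
    π.monomialSymm (NCSeries.word i) =
      if π = ofRel (Setoid.ker i) then 1 else 0 := by
  refine (NCSeries.formalSum_subtype_word _ i).trans (if_congr ⟨fun h => ?_, ?_⟩ rfl rfl)
  · exact ext_sameBlock fun j k => by rw [sameBlock_ofRel, Setoid.ker_def, h]
  · rintro rfl j k
    rw [sameBlock_ofRel, Setoid.ker_def]

theorem powerSum_eq_zero_of_length (π : SetPartition n) {w : FreeMonoid ℕ+}
    (hw : w.toList.length ≠ n) : π.powerSum w = 0 :=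
  NCSeries.formalSum_eq_zero fun a ha => hw (by rw [← ha, NCSeries.length_toList_word])

theorem monomialSymm_eq_zero_of_length (π : SetPartition n) {w : FreeMonoid ℕ+}
    (hw : w.toList.length ≠ n) : π.monomialSymm w = 0 :=
  NCSeries.formalSum_eq_zero fun a ha => hw (by rw [← ha, NCSeries.length_toList_word])

theorem sum_smul_apply (c : SetPartition n → ℂ) (t : SetPartition n → NCSeries)
    (w : FreeMonoid ℕ+) : (∑ π, c π • t π) w = ∑ π, c π * t π w := by
  simp [Finset.sum_apply]

open Classical in
/-- The power sum functions are the sums of the monomial functions of coarser partitions. -/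
theorem powerSum_eq_sum_monomialSymm (π : SetPartition n) :
    π.powerSum = ∑ ρ : SetPartition n, (if π ≤ ρ then 1 else 0 : ℂ) • ρ.monomialSymm := by
  funext w
  rw [sum_smul_apply]
  by_cases hw : w.toList.length = n
  · obtain ⟨i, rfl⟩ := NCSeries.exists_word_eq hw
    simp only [monomialSymm_word, powerSum_word, mul_ite, mul_one, mul_zero, Finset.sum_ite_eq',
      Finset.mem_univ, if_true]
    refine if_congr ?_ rfl rfl
    simp only [le_iff_sameBlock, sameBlock_ofRel, Setoid.ker_def]
  · rw [powerSum_eq_zero_of_length _ hw]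
    simp [monomialSymm_eq_zero_of_length _ hw]

/-- The coefficient of the word of `ρ.canonicalSeq` isolates the term of `ρ`. -/
theorem monomialSymm_coeff_unique {a b : SetPartition n → ℂ}
    (h : ∑ π, a π • π.monomialSymm = ∑ π, b π • π.monomialSymm) : a = b := by
  classical
  funext ρ
  have hρ : ofRel (Setoid.ker ρ.canonicalSeq) = ρ := ext_sameBlock fun j k => by
    rw [sameBlock_ofRel, Setoid.ker_def, canonicalSeq_eq_iff]
  have := congrFun h (NCSeries.word ρ.canonicalSeq)
  simpa [sum_smul_apply, monomialSymm_word, hρ] using this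

/-- The word of `ρ.canonicalSeq` reads off the sum of the coefficients of all `π ≤ ρ`, a
unitriangular system solved by induction from the finest partitions. -/
theorem powerSum_coeff_unique {a b : SetPartition n → ℂ}
    (h : ∑ π, a π • π.powerSum = ∑ π, b π • π.powerSum) : a = b := by
  classical
  funext ρ
  induction ρ using WellFoundedLT.induction with
  | ind ρ ih =>
    have h1 := congrFun h (NCSeries.word ρ.canonicalSeq)
    simp only [sum_smul_apply, powerSum_canonicalSeq] at h1
    rw [← Finset.add_sum_erase _ _ (Finset.mem_univ ρ),
      ← Finset.add_sum_erase _ _ (Finset.mem_univ ρ)] at h1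
    have h2 : ∀ π ∈ Finset.univ.erase ρ, a π * (if π ≤ ρ then 1 else 0 : ℂ) =
        b π * (if π ≤ ρ then 1 else 0 : ℂ) := fun π hπ => by
      split_ifs with hle
      · rw [ih π (lt_of_le_of_ne hle (Finset.ne_of_mem_erase hπ))]
      · simp
    rw [Finset.sum_congr rfl h2] at h1
    simpa using add_right_cancel h1

/-- The partition of the positions into the cycles of a permutation. -/
noncomputable def ofPerm (σ : Equiv.Perm (Fin n)) : SetPartition n :=
  ofRel (Equiv.Perm.SameCycle.setoid σ)

/-- This identifies the survival condition for `σ` in the cycle sum with the support of `p_π`. -/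
theorem forall_sameBlock_ofPerm_iff {σ : Equiv.Perm (Fin n)} {i : Fin n → ℕ+} :
    (∀ j k, (ofPerm σ).SameBlock j k → i j = i k) ↔ ∀ j, i (σ j) = i j := by
  simp only [ofPerm, sameBlock_ofRel]
  constructor
  · exact fun h j => (h j (σ j) (Equiv.Perm.sameCycle_apply_right.2
      (Equiv.Perm.SameCycle.refl σ j))).symm
  · intro h j k hjk
    obtain ⟨m, hm⟩ := Equiv.Perm.SameCycle.exists_nat_pow_eq hjk
    rw [← hm]
    clear hm
    induction m with
    | zero => rfl
    | succ m ih => rw [pow_succ', Equiv.Perm.mul_apply, h, ih]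

end SetPartition

/-! ### The power sum expansion and the main theorem. -/

open SetPartition in
open Classical in
theorem Digraph.redeiBerge_eq_sum_powerSum {V : Type*} {n : ℕ} (X : Digraph V) (v : Fin n ≃ V) :
    X.redeiBerge v = ∑ π : SetPartition n,
      ((∑ σ : Equiv.Perm (Fin n) with ofPerm σ = π,
        cycleWeight (nonArc fun a b => X.Adj (v a) (v b)) σ : ℤ) : ℂ) • π.powerSum := by
  funext w
  rw [sum_smul_apply]
  by_cases hw : w.toList.length = n
  · obtain ⟨i, rfl⟩ := NCSeries.exists_word_eq hw
    rw [redeiBerge_word, Int.cast_sum, ← Finset.sum_fiberwise _ ofPerm]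
    refine Finset.sum_congr rfl fun π _ => ?_
    rw [Int.cast_sum, Finset.sum_mul]
    refine Finset.sum_congr rfl fun σ hσ => ?_
    obtain rfl := (Finset.mem_filter.1 hσ).2
    simp only [powerSum_word, forall_sameBlock_ofPerm_iff]
    split_ifs <;> simp
  · rw [Finset.sum_eq_zero fun π _ => by rw [powerSum_eq_zero_of_length π hw, mul_zero]]
    exact NCSeries.formalSum_eq_zero fun a ha => hw (by rw [← ha, NCSeries.length_toList_word])

theorem mainTheorem10 {V : Type*} {n : ℕ} (X : Digraph V) (v : Fin n ≃ V) :
    (∃ c : SetPartition n → ℤ,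
      X.redeiBerge v = ∑ π : SetPartition n, (c π : ℂ) • π.powerSum ∧
      (∀ c' : SetPartition n → ℂ,
        X.redeiBerge v = ∑ π : SetPartition n, c' π • π.powerSum → ∀ π, c' π = (c π : ℂ)) ∧
      ((∀ k : ℕ, Even k → ¬ X.HasCycleOfLength k) → ∀ π, c π ≠ 0 → 0 < c π)) ∧
    (∃ d : SetPartition n → ℤ,
      X.redeiBerge v = ∑ π : SetPartition n, (d π : ℂ) • π.monomialSymm ∧
      (∀ d' : SetPartition n → ℂ,
        X.redeiBerge v = ∑ π : SetPartition n, d' π • π.monomialSymm →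
          ∀ π, d' π = (d π : ℂ))) := by
  classical
  have hp := X.redeiBerge_eq_sum_powerSum v
  -- Expanding each power sum in monomial functions gives `d_ρ` as the sum of `c_π` over `π ≤ ρ`,
  -- again an integer.
  have hm : X.redeiBerge v = ∑ ρ : SetPartition n,
      ((∑ π : SetPartition n, if π ≤ ρ then
        ∑ σ : Equiv.Perm (Fin n) with SetPartition.ofPerm σ = π,
          cycleWeight (nonArc fun a b => X.Adj (v a) (v b)) σ else 0 : ℤ) : ℂ) •
        ρ.monomialSymm := by
    refine hp.trans ?_
    simp only [SetPartition.powerSum_eq_sum_monomialSymm, Finset.smul_sum]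
    rw [Finset.sum_comm]
    refine Finset.sum_congr rfl fun ρ _ => ?_
    rw [Int.cast_sum, Finset.sum_smul]
    refine Finset.sum_congr rfl fun π _ => ?_
    split_ifs <;> simp
  refine ⟨⟨_, hp, fun c' hc' => congrFun (SetPartition.powerSum_coeff_unique (hc'.symm.trans hp)),
    fun h π hπ => lt_of_le_of_ne (Finset.sum_nonneg fun σ _ => ?_) hπ.symm⟩,
    ⟨_, hm, fun d' hd' => congrFun (SetPartition.monomialSymm_coeff_unique (hd'.symm.trans hm))⟩⟩
  exact cycleWeight_nonArc_nonneg
    (fun γ hγ ha => X.odd_card_support_of_isCycle v h hγ ha) σ
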